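/- Consider any finite extensive-form game with players T1, T2 (the team) and O, possibly chance moves, imperfect information and perfect recall. For a player $i$ let $\mathcal I_i$ be the collection of information sets (a partition into non-empty sets of the non-leaf nodes of $i$, all nodes of $I\in\mathcal I_i$ having the same non-empty action set $A_I$), $\Sigma_i=\{(I,a): I\in\mathcal I_i,\ a\in A_I\}\cup\{\varnothing\}$ the set of sequences, and $\sigma(I)\in\Sigma_i$ the parent sequence of $I$, i.e. the last information set–action pair of player $i$ on the path from the root to (any node of) $I$, or $\varnothing$ if there is none. Information sets $I\in\mathcal I_{T1}$ and $J\in\mathcal I_{T2}$ are connected, $I\rightleftharpoons J$, if there are $v\in I$, $w\in J$ such that one of them lies on the path from the root to the other. A pair $(\sigma_1,\sigma_2)\in\Sigma_{T1}\times\Sigma_{T2}$ is relevant, $\sigma_1\bowtie\sigma_2$, if one of the two is $\varnothing$, or $\sigma_1=(I,a)$, $\sigma_2=(J,b)$ with $I\rightleftharpoons J$; $\Sigma_{T1}\bowtie\Sigma_{T2}$ is the set of relevant pairs. Likewise $I\bowtie\sigma_2$ if $\sigma_2=\varnothing$, or $\sigma_2=(J,b)$ with $I\rightleftharpoons J$;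 and symmetrically for $\sigma_1\bowtie J$. A reduced-normal-form plan of player $i$ chooses an action at exactly those information sets of $i$ that are reachable given the other choices of the plan; $\Pi_i$ is the set of these plans, $\Pi_i(\varnothing)=\Pi_i$, and $\Pi_i((I,a))$ is the set of plans that prescribe all actions of player $i$ on the path from the root to $I$ and play $a$ at $I$. Let $\Delta(X)$ denote the probability simplex over the finite set $X$. The polytope of extensive-form correlation plans $\Xi_T\subseteq\mathbb R^{\Sigma_{T1}\bowtie\Sigma_{T2}}$ is the set of all vectors $\xi$ of the form $$\xi[\sigma_1,\sigma_2]=\sum_{\pi_1\in\Pi_{T1}(\sigma_1),\ \pi_2\in\Pi_{T2}(\sigma_2)}\mu(\pi_1,\pi_2)\qquad((\sigma_1,\sigma_2)\in\Sigma_{T1}\bowtie\Sigma_{T2}),\qquad \mu\in\Delta(\Pi_{T1}\times\Pi_{T2}).$$ The von Stengel–Forges polytope $\mathcal V_T$ is the set of all $\xi\in\mathbb R_{\ge0}^{\Sigma_{T1}\bowtie\Sigma_{T2}}$ with $\xi[\varnothing,\varnothing]=1$, with $\sum_{a\in A_I}\xi[(I,a),\sigma_2]=\xi[\sigma(I),\sigma_2]$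 for all $I\in\mathcal I_{T1}$, $\sigma_2\in\Sigma_{T2}$ with $I\bowtie\sigma_2$, and with $\sum_{b\in A_J}\xi[\sigma_1,(J,b)]=\xi[\sigma_1,\sigma(J)]$ for all $J\in\mathcal I_{T2}$, $\sigma_1\in\Sigma_{T1}$ with $\sigma_1\bowtie J$. The sets of semi-randomized correlation plans are $$\Xi^*_{T1}=\{\xi\in\mathcal V_T:\xi[\varnothing,\sigma_2]\in\{0,1\}\ \ \forall\sigma_2\in\Sigma_{T2}\},\qquad \Xi^*_{T2}=\{\xi\in\mathcal V_T:\xi[\sigma_1,\varnothing]\in\{0,1\}\ \ \forall\sigma_1\in\Sigma_{T1}\}.$$ Then, in every such game, $\Xi_T=\operatorname{co}\Xi^*_{T1}=\operatorname{co}\Xi^*_{T2}=\operatorname{co}(\Xi^*_{T1}\cup\Xi^*_{T2})$, where $\operatorname{co}$ denotes the convex hull. -/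

import Mathlib

universe u v

/-- The three strategic players: the two team members and their opponent. -/
inductive Player where
  | T1
  | T2
  | O
  deriving DecidableEq

/-- A finite game tree. A node is the list of the actions taken from the root to it, with the most
recent action first: the root is `[]`, the children of `h` are the nodes `a :: h`, and the path from
the root to `h` passes through `g` if and only if `g` is a suffix of `h`. -/
structure GameTree where
  Action : Type u
  nodes : Finset (List Action)
  root_mem : [] ∈ nodes
  parent_mem : ∀ (a : Action) (h : List Action), a :: h ∈ nodes → h ∈ nodes
  /-- Who moves at a node; `none` stands for the chance player. The values at leaves and outside of
  the tree are never used. -/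
  turn : List Action → Option Player

namespace GameTree

/-- Nodes without outgoing edges. -/
def IsLeaf (G : GameTree.{u}) (h : List G.Action) : Prop :=
  h ∈ G.nodes ∧ ∀ a, a :: h ∉ G.nodes

/-- `h` is a non-leaf node at which `p` moves (`some i` is a player, `none` is chance). -/
def MovesAt (G : GameTree.{u}) (p : Option Player) (h : List G.Action) : Prop :=
  h ∈ G.nodes ∧ (∃ a, a :: h ∈ G.nodes) ∧ G.turn h = p

/-- The (non-leaf) nodes that belong to Player `i`. -/
abbrev DecisionNode (G : GameTree.{u}) (i : Player) : Type u :=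
  {h : List G.Action // G.MovesAt (some i) h}

end GameTree

/-- A game tree with information sets. The nodes of each player are partitioned into the fibres of
`info`, which are non-empty; all nodes of an information set have the same available actions. -/
structure InfoTree extends GameTree.{u} where
  Infoset : Player → Type v
  info : ∀ i : Player, toGameTree.DecisionNode i → Infoset i
  info_surjective : ∀ i, Function.Surjective (info i)
  /-- The set `A_I` of the actions available at the information set `I`. -/
  actions : ∀ {i : Player}, Infoset i → Finset Action
  mem_actions : ∀ {i : Player} (w : toGameTree.DecisionNode i) (a : Action),
    a ∈ actions (info i w) ↔ a :: w.1 ∈ nodes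

namespace InfoTree

variable (G : InfoTree.{u, v})

/-- An information set of Player `i` together with one of its actions: a non-empty sequence. -/
abbrev Move (i : Player) : Type (max u v) :=
  Σ I : G.Infoset i, {a : G.Action // a ∈ G.actions I}

/-- The sequences of Player `i`; `none` is the empty sequence. -/
abbrev Seq (i : Player) : Type (max u v) := Option (G.Move i)

/-- The move made by Player `i` on the edge from `h` to `a :: h`. -/
def moveOf (i : Player) (a : G.Action) (h : List G.Action) (hah : a :: h ∈ G.nodes)
    (hi : G.turn h = some i) : G.Move i :=
  let w : G.DecisionNode i := ⟨h, G.parent_mem a h hah, ⟨a, hah⟩, hi⟩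
  ⟨G.info i w, a, (G.mem_actions w a).2 hah⟩

/-- The list of the moves that Player `i` makes on the path from the root to a node, with the most
recent move first. -/
def ownHist (i : Player) : (h : List G.Action) → h ∈ G.nodes → List (G.Move i)
  | [], _ => []
  | a :: h, hah =>
    if hi : G.turn h = some i then
      G.moveOf i a h hah hi :: ownHist i h (G.parent_mem a h hah)
    else ownHist i h (G.parent_mem a h hah)

/-- Perfect recall: any two nodes of an information set of a player are preceded by the same moves
of that player, in the same order. -/
def PerfectRecall : Prop :=
  ∀ (i : Player) (w w' : G.DecisionNode i), G.info i w = G.info i w' →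
    G.ownHist i w.1 w.2.1 = G.ownHist i w'.1 w'.2.1

end InfoTree

/-- A finite three-player extensive-form game with chance moves, imperfect information and perfect
recall. The payoffs are arbitrary; zero-sum games are a special case. -/
structure Game extends InfoTree.{u, v} where
  perfectRecall : toInfoTree.PerfectRecall
  chance : ∀ h : List Action, toGameTree.MovesAt none h → PMF {a : Action // a :: h ∈ nodes}
  payoff : {z : List Action // toGameTree.IsLeaf z} → Player → ℝ

namespace Game

variable (G : Game.{u, v})

instance instFiniteInfoset (i : Player) : Finite (G.Infoset i) := by
  have hfin : Finite (G.DecisionNode i) :=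
    (G.nodes.finite_toSet.subset fun _ hh => hh.1).to_subtype
  exact Finite.of_surjective (G.info i) (G.info_surjective i)

/-- The sequence of moves of Player `i` on the way to (any node of) the information set `I`. -/
noncomputable def infosetHist {i : Player} (I : G.Infoset i) : List (G.Move i) :=
  let w := Function.surjInv (G.info_surjective i) I
  G.ownHist i w.1 w.2.1

theorem infosetHist_info {i : Player} (w : G.DecisionNode i) :
    G.infosetHist (G.info i w) = G.ownHist i w.1 w.2.1 :=
  G.perfectRecall i _ _ (Function.surjInv_eq (G.info_surjective i) (G.info i w))

/-- The parent sequence `σ(I)` of an information set: the last move of the player before it. -/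
noncomputable def parentSeq {i : Player} (I : G.Infoset i) : G.Seq i := (G.infosetHist I).head?

/-- Connected information sets: some node of one lies on the path from the root to some node of the
other. -/
def Connected {i j : Player} (I : G.Infoset i) (J : G.Infoset j) : Prop :=
  ∃ (w : G.DecisionNode i) (x : G.DecisionNode j), G.info i w = I ∧ G.info j x = J ∧
    (x.1 <:+ w.1 ∨ w.1 <:+ x.1)

/-- The pair consisting of a sequence of Player `i` and an information set of Player `j` is
relevant. -/
def RelevantInfo {i j : Player} (σ : G.Seq i) (J : G.Infoset j) : Prop :=
  ∀ m : G.Move i, σ = some m → G.Connected m.1 J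

/-- Relevant pairs of sequences: one of the two is empty, or their information sets are
connected. -/
def Relevant {i j : Player} (σ : G.Seq i) (τ : G.Seq j) : Prop :=
  σ = none ∨ τ = none ∨
    ∃ (m : G.Move i) (n : G.Move j), σ = some m ∧ τ = some n ∧ G.Connected m.1 n.1

/-- The set of the relevant pairs of sequences of Players `i` and `j`. -/
abbrev RelPair (i j : Player) : Type (max u v) :=
  {p : G.Seq i × G.Seq j // G.Relevant p.1 p.2}

theorem Connected.symm {i j : Player} {I : G.Infoset i} {J : G.Infoset j}
    (h : G.Connected I J) : G.Connected J I := by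
  obtain ⟨w, x, hw, hx, h⟩ := h
  exact ⟨x, w, hx, hw, h.symm⟩

theorem Relevant.symm {i j : Player} {σ : G.Seq i} {τ : G.Seq j}
    (h : G.Relevant σ τ) : G.Relevant τ σ := by
  rcases h with h | h | ⟨m, n, h1, h2, h⟩
  · exact Or.inr (Or.inl h)
  · exact Or.inl h
  · exact Or.inr (Or.inr ⟨n, m, h2, h1, Connected.symm G h⟩)

theorem relevant_move {i j : Player} {σ : G.Seq i} {J : G.Infoset j}
    (h : G.RelevantInfo σ J) (b : {b : G.Action // b ∈ G.actions J}) :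
    G.Relevant σ (some (⟨J, b⟩ : G.Move j)) := by
  rcases hs : σ with _ | m
  · exact Or.inl rfl
  · exact Or.inr (Or.inr ⟨m, ⟨J, b⟩, rfl, rfl, h m hs⟩)

/-- Every move of Player `i` on the path to a node is made at a node on that path. -/
theorem exists_node_of_mem_ownHist {i : Player} (h : List G.Action) (hh : h ∈ G.nodes)
    (m : G.Move i) (hm : m ∈ G.ownHist i h hh) :
    ∃ w : G.DecisionNode i, G.info i w = m.1 ∧ w.1 <:+ h := by
  induction h with
  | nil => simp [InfoTree.ownHist] at hm
  | cons a h ih =>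
    rw [InfoTree.ownHist] at hm
    split_ifs at hm with hi
    · rcases List.mem_cons.1 hm with rfl | hm
      · exact ⟨_, rfl, List.suffix_cons a h⟩
      · obtain ⟨w, hw, hs⟩ := ih _ hm
        exact ⟨w, hw, hs.trans (List.suffix_cons a h)⟩
    · obtain ⟨w, hw, hs⟩ := ih _ hm
      exact ⟨w, hw, hs.trans (List.suffix_cons a h)⟩

theorem relevant_parentSeq {i j : Player} {σ : G.Seq i} {J : G.Infoset j}
    (h : G.RelevantInfo σ J) : G.Relevant σ (G.parentSeq J) := by
  rcases hs : σ with _ | m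
  · exact Or.inl rfl
  rcases hp : G.parentSeq J with _ | n
  · exact Or.inr (Or.inl rfl)
  refine Or.inr (Or.inr ⟨m, n, rfl, rfl, ?_⟩)
  obtain ⟨w, x, hw, rfl, hwx⟩ := h m hs
  have hn : n ∈ G.ownHist j x.1 x.2.1 := by
    rw [parentSeq, infosetHist_info] at hp
    exact List.mem_of_mem_head? hp
  obtain ⟨y, hy, hyx⟩ := G.exists_node_of_mem_ownHist x.1 x.2.1 n hn
  refine ⟨w, y, hw, hy, ?_⟩
  rcases hwx with hwx | hwx
  · exact Or.inl (hyx.trans hwx)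
  · exact List.suffix_or_suffix_of_suffix hyx hwx

/-- Player `i` can reach the information set `I` if his choices are those of the (partial) plan
`π`. -/
def Reachable {i : Player} (π : ∀ I : G.Infoset i, Option {a : G.Action // a ∈ G.actions I})
    (I : G.Infoset i) : Prop :=
  ∃ w : G.DecisionNode i, G.info i w = I ∧ ∀ m ∈ G.ownHist i w.1 w.2.1, π m.1 = some m.2

/-- Reduced-normal-form plans of Player `i`: a choice of an action at exactly those information sets
that are reachable under the other choices of the plan. -/
abbrev Plan (i : Player) : Type (max u v) :=
  {π : ∀ I : G.Infoset i, Option {a : G.Action // a ∈ G.actions I} //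
    ∀ I, (π I).isSome ↔ G.Reachable π I}

noncomputable instance instFintypePlan (i : Player) : Fintype (G.Plan i) := Fintype.ofFinite _

/-- `Π_i(I)`: the plans that prescribe all actions of Player `i` on the path from the root to
`I`. -/
def plansToInfoset {i : Player} (I : G.Infoset i) : Set (G.Plan i) :=
  {π | ∀ m ∈ G.infosetHist I, π.1 m.1 = some m.2}

/-- `Π_i(σ)`: all plans if `σ` is empty, and the plans in `Π_i(I)` that play `a` at `I` if
`σ = (I, a)`. -/
def plansOf {i : Player} : G.Seq i → Set (G.Plan i)
  | none => Set.univ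
  | some m => {π | π ∈ G.plansToInfoset m.1 ∧ π.1 m.1 = some m.2}

open Classical in
/-- The extensive-form correlation plan induced by a correlated distribution of play `μ`. -/
noncomputable def correlationPlan (i j : Player) (μ : G.Plan i × G.Plan j → ℝ) :
    G.RelPair i j → ℝ :=
  fun p => ∑ π : G.Plan i × G.Plan j with π.1 ∈ G.plansOf p.1.1 ∧ π.2 ∈ G.plansOf p.1.2, μ π

/-- The polytope of correlation plans of Players `i` and `j`. -/
noncomputable def correlationPlans (i j : Player) : Set (G.RelPair i j → ℝ) :=
  G.correlationPlan i j '' stdSimplex ℝ (G.Plan i × G.Plan j)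

/-- The von Stengel-Forges polytope of Players `i` and `j`. -/
def vonStengelForges (i j : Player) : Set (G.RelPair i j → ℝ) :=
  {ξ | (∀ p, 0 ≤ ξ p) ∧
    ξ ⟨(none, none), Or.inl rfl⟩ = 1 ∧
    (∀ (I : G.Infoset i) (τ : G.Seq j) (h : G.RelevantInfo τ I),
      ∑ a : {a : G.Action // a ∈ G.actions I},
          ξ ⟨(some ⟨I, a⟩, τ), Relevant.symm G (G.relevant_move h a)⟩ =
        ξ ⟨(G.parentSeq I, τ), Relevant.symm G (G.relevant_parentSeq h)⟩) ∧
    (∀ (J : G.Infoset j) (σ : G.Seq i) (h : G.RelevantInfo σ J),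
      ∑ b : {b : G.Action // b ∈ G.actions J},
          ξ ⟨(σ, some ⟨J, b⟩), G.relevant_move h b⟩ =
        ξ ⟨(σ, G.parentSeq J), G.relevant_parentSeq h⟩)}

/-- Semi-randomized correlation plans for the first of the two players: the second player `j` plays
deterministically. -/
def semiRandomizedFst (i j : Player) : Set (G.RelPair i j → ℝ) :=
  {ξ | ξ ∈ G.vonStengelForges i j ∧
    ∀ τ : G.Seq j, ξ ⟨(none, τ), Or.inl rfl⟩ ∈ ({0, 1} : Set ℝ)}

/-- Semi-randomized correlation plans for the second of the two players: the first player `i` plays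
deterministically. -/
def semiRandomizedSnd (i j : Player) : Set (G.RelPair i j → ℝ) :=
  {ξ | ξ ∈ G.vonStengelForges i j ∧
    ∀ σ : G.Seq i, ξ ⟨(σ, none), Or.inr (Or.inl rfl)⟩ ∈ ({0, 1} : Set ℝ)}

end Game

/-! Every correlation plan is a mixture of products of two reduced-normal-form plans
(`correlationPlans_subset`). Such a product has 0/1 marginals on both sides, hence is
semi-randomized for either player; this gives one inclusion in each equality.

Conversely, the correlation plans form a convex set, so it suffices that each semi-randomized plan
is one of them. The crux is that a deterministic marginal forces a factorization:
`eq_mul_of_mem_semiRandomizedFst` shows `ξ[σ, τ] = ξ[σ, ∅] * ξ[∅, τ]` on all relevant pairs. Both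
factors are realization plans, so Kuhn's theorem (`IsRealizationPlan.exists_mixed`) turns each into
a mixed strategy, and the product of the two mixed strategies induces `ξ`. The statement for the
other player follows by exchanging the roles. -/

namespace Game

variable (G : Game.{u, v})

/-! ### Histories of sequences -/

/-- The moves of a sequence, the most recent one first. -/
noncomputable def seqHist {i : Player} : G.Seq i → List (G.Move i)
  | none => []
  | some m => m :: G.infosetHist m.1

/-- Perfect recall enters here, through `infosetHist_info`: a player's last move determines all of
that player's earlier moves. -/
theorem seqHist_head?_ownHist {i : Player} (h : List G.Action) (hh : h ∈ G.nodes) :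
    G.seqHist (G.ownHist i h hh).head? = G.ownHist i h hh := by
  induction h with
  | nil => rfl
  | cons a h ih =>
    rw [InfoTree.ownHist]
    split_ifs with hi
    · simp only [List.head?_cons, seqHist, List.cons.injEq, true_and]
      exact G.infosetHist_info (i := i) _
    · exact ih _

theorem seqHist_parentSeq {i : Player} (I : G.Infoset i) :
    G.seqHist (G.parentSeq I) = G.infosetHist I :=
  G.seqHist_head?_ownHist _ _

/-- Induction along the parent relation of sequences. -/
theorem seq_induction {i : Player} {P : G.Seq i → Prop} (h0 : P none)
    (hs : ∀ (I : G.Infoset i) (a : {a : G.Action // a ∈ G.actions I}),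
      P (G.parentSeq I) → P (some ⟨I, a⟩)) (σ : G.Seq i) : P σ := by
  induction hn : (G.seqHist σ).length using Nat.strong_induction_on generalizing σ with
  | _ n ih =>
    rcases σ with _ | ⟨I, a⟩
    · exact h0
    · refine hs I a (ih _ ?_ _ rfl)
      rw [seqHist_parentSeq, ← hn]
      simp [seqHist]

theorem seqHist_suffix_of_mem {i : Player} (σ : G.Seq i) :
    ∀ m ∈ G.seqHist σ, G.seqHist (some m) <:+ G.seqHist σ := by
  induction σ using G.seq_induction with
  | h0 => simp [seqHist]
  | hs I a ih =>
    intro m hm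
    rcases List.mem_cons.1 hm with rfl | hm
    · exact List.suffix_rfl
    · rw [seqHist_parentSeq] at ih
      exact (ih m hm).trans (List.suffix_cons _ _)

theorem infosetHist_suffix_of_mem {i : Player} {I : G.Infoset i} {m : G.Move i}
    (hm : m ∈ G.infosetHist I) : m :: G.infosetHist m.1 <:+ G.infosetHist I := by
  have := G.seqHist_suffix_of_mem (G.parentSeq I)
  rw [seqHist_parentSeq] at this
  exact this m hm

/-- Otherwise the history of `I` would contain a strictly longer copy of itself. This is what makes
the choices along a history independent in Kuhn's theorem. -/
theorem ne_of_mem_infosetHist {i : Player} {I : G.Infoset i} {m : G.Move i}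
    (hm : m ∈ G.infosetHist I) : m.1 ≠ I := by
  rintro rfl
  have := (G.infosetHist_suffix_of_mem hm).length_le
  simp at this

theorem actions_nonempty {i : Player} (I : G.Infoset i) :
    Nonempty {a : G.Action // a ∈ G.actions I} := by
  obtain ⟨w, rfl⟩ := G.info_surjective i I
  obtain ⟨a, ha⟩ := w.2.2.1
  exact ⟨⟨a, (G.mem_actions w a).2 ha⟩⟩

theorem reachable_iff {i : Player}
    (π : ∀ I : G.Infoset i, Option {a : G.Action // a ∈ G.actions I}) (I : G.Infoset i) :
    G.Reachable π I ↔ ∀ m ∈ G.infosetHist I, π m.1 = some m.2 := by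
  constructor
  · rintro ⟨w, rfl, h⟩
    rwa [infosetHist_info]
  · intro h
    obtain ⟨w, rfl⟩ := G.info_surjective i I
    rw [infosetHist_info] at h
    exact ⟨w, rfl, h⟩

theorem mem_plansOf_iff {i : Player} (π : G.Plan i) (σ : G.Seq i) :
    π ∈ G.plansOf σ ↔ ∀ m ∈ G.seqHist σ, π.1 m.1 = some m.2 := by
  rcases σ with _ | m
  · simp [plansOf, seqHist]
  · simp [plansOf, seqHist, plansToInfoset, and_comm]

theorem mem_plansOf_parentSeq {i : Player} (π : G.Plan i) (I : G.Infoset i) :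
    π ∈ G.plansOf (G.parentSeq I) ↔ (π.1 I).isSome := by
  rw [mem_plansOf_iff, seqHist_parentSeq, π.2 I, reachable_iff]

/-- A reduced plan acts only where it can arrive, so acting at `I` already implies the moves leading
to `I`. -/
theorem mem_plansOf_some {i : Player} (π : G.Plan i) (I : G.Infoset i)
    (a : {a : G.Action // a ∈ G.actions I}) :
    π ∈ G.plansOf (some ⟨I, a⟩) ↔ π.1 I = some a := by
  constructor
  · exact fun h => h.2
  · refine fun h => ⟨?_, h⟩
    have := (π.2 I).1 (by simp [h])
    rwa [reachable_iff] at this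

/-! ### Realization plans and Kuhn's theorem -/

/-- Realization plans (sequence-form strategies) of Player `i`. -/
def IsRealizationPlan {i : Player} (x : G.Seq i → ℝ) : Prop :=
  (∀ σ, 0 ≤ x σ) ∧ x none = 1 ∧
    ∀ I : G.Infoset i, ∑ a : {a : G.Action // a ∈ G.actions I}, x (some ⟨I, a⟩) =
      x (G.parentSeq I)

open Classical in
/-- The realization plan of a reduced-normal-form plan. -/
noncomputable def planIndicator {i : Player} (π : G.Plan i) (σ : G.Seq i) : ℝ :=
  if π ∈ G.plansOf σ then 1 else 0

theorem planIndicator_mem {i : Player} (π : G.Plan i) (σ : G.Seq i) :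
    G.planIndicator π σ ∈ ({0, 1} : Set ℝ) := by
  unfold planIndicator
  split_ifs <;> simp

theorem isRealizationPlan_planIndicator {i : Player} (π : G.Plan i) :
    G.IsRealizationPlan (G.planIndicator π) := by
  classical
  refine ⟨fun σ => ?_, by simp [planIndicator, plansOf], fun I => ?_⟩
  · unfold planIndicator
    split_ifs <;> norm_num
  · simp only [planIndicator, mem_plansOf_some, mem_plansOf_parentSeq]
    cases h : π.1 I with
    | none => simp
    | some a => simp

open Classical in
/-- The reduced-normal-form plan of a choice of an action at every information set. -/
noncomputable def reducePlan {i : Player}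
    (s : ∀ I : G.Infoset i, {a : G.Action // a ∈ G.actions I}) : G.Plan i :=
  ⟨fun I => if ∀ m ∈ G.infosetHist I, s m.1 = m.2 then some (s I) else none, fun I => by
    rw [reachable_iff]
    constructor
    · intro h m hm
      have hI : ∀ m ∈ G.infosetHist I, s m.1 = m.2 := by
        by_contra hI
        simp [hI] at h
      have hs := (G.infosetHist_suffix_of_mem hm).subset
      rw [if_pos fun n hn => hI n (hs (List.mem_cons_of_mem _ hn)), hI m hm]
    · intro h
      have hI : ∀ m ∈ G.infosetHist I, s m.1 = m.2 := by
        intro m hm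
        have := h m hm
        split_ifs at this
        exact Option.some.inj this
      simp only [if_pos hI, Option.isSome_some]⟩

theorem reducePlan_mem_plansOf {i : Player}
    (s : ∀ I : G.Infoset i, {a : G.Action // a ∈ G.actions I}) (σ : G.Seq i) :
    G.reducePlan s ∈ G.plansOf σ ↔ ∀ m ∈ G.seqHist σ, s m.1 = m.2 := by
  classical
  rw [mem_plansOf_iff]
  constructor
  · intro h m hm
    have := h m hm
    simp only [reducePlan] at this
    split_ifs at this
    exact Option.some.inj this
  · intro h m hm
    have hs := (G.seqHist_suffix_of_mem σ m hm).subset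
    simp only [reducePlan]
    rw [if_pos fun n hn => h n (hs (List.mem_cons_of_mem _ hn)), h m hm]

/-- The behavior strategy of a realization plan. -/
theorem IsRealizationPlan.exists_behavior {i : Player} {x : G.Seq i → ℝ}
    (hx : G.IsRealizationPlan x) :
    ∃ β : ∀ I : G.Infoset i, {a : G.Action // a ∈ G.actions I} → ℝ,
      (∀ I a, 0 ≤ β I a) ∧ (∀ I, ∑ a, β I a = 1) ∧
        ∀ I a, x (some ⟨I, a⟩) = β I a * x (G.parentSeq I) := by
  classical
  have key : ∀ I : G.Infoset i, ∃ b : {a : G.Action // a ∈ G.actions I} → ℝ,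
      (∀ a, 0 ≤ b a) ∧ ∑ a, b a = 1 ∧ ∀ a, x (some ⟨I, a⟩) = b a * x (G.parentSeq I) := by
    intro I
    by_cases h : x (G.parentSeq I) = 0
    · obtain ⟨a₀⟩ := G.actions_nonempty I
      -- At an information set of realization weight zero any distribution works; a point mass is
      -- chosen.
      refine ⟨Pi.single a₀ 1, fun a => ?_, by simp, fun a => ?_⟩
      · by_cases ha : a = a₀
        · subst ha; simp
        · simp [ha]
      · have hI := hx.2.2 I
        rw [h, Finset.sum_eq_zero_iff_of_nonneg fun a _ => hx.1 _] at hI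
        rw [h, mul_zero, hI a (Finset.mem_univ a)]
    · refine ⟨fun a => x (some ⟨I, a⟩) / x (G.parentSeq I),
        fun a => div_nonneg (hx.1 _) (hx.1 _), ?_, fun a => (div_mul_cancel₀ _ h).symm⟩
      rw [← Finset.sum_div, hx.2.2 I, div_self h]
  choose β h1 h2 h3 using key
  exact ⟨β, h1, h2, h3⟩

/-- Under a product distribution, the event of following a list of independent choices followed by
one more choice has the product probability. -/
theorem sum_prod_cons_filter {ι : Type*} [Fintype ι] [DecidableEq ι] {A : ι → Type*}
    [∀ k, Fintype (A k)] [∀ k, DecidableEq (A k)] (β : ∀ k, A k → ℝ)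
    (hβ : ∀ k, ∑ a, β k a = 1) (m : Σ k, A k) (l : List (Σ k, A k)) (hm : ∀ n ∈ l, n.1 ≠ m.1) :
    ∑ s : ∀ k, A k with ∀ n ∈ m :: l, s n.1 = n.2, ∏ k, β k (s k) =
      β m.1 m.2 * ∑ s : ∀ k, A k with ∀ n ∈ l, s n.1 = n.2, ∏ k, β k (s k) := by
  -- The event constrains each coordinate separately, so it is a box and the sum of products becomes
  -- a product of sums.
  have key : ∀ l : List (Σ k, A k),
      ∑ s : ∀ k, A k with ∀ n ∈ l, s n.1 = n.2, ∏ k, β k (s k) =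
        ∏ k, ∑ a : A k with ∀ n ∈ l, n.1 = k → n = ⟨k, a⟩, β k a := by
    intro l
    rw [Finset.prod_univ_sum]
    refine Finset.sum_congr ?_ fun _ _ => rfl
    ext s
    simp only [Finset.mem_filter, Finset.mem_univ, true_and, Fintype.mem_piFinset]
    constructor
    · rintro h _ n hn rfl
      rw [h n hn]
    · intro h n hn
      have := h n.1 n hn rfl
      rw [Sigma.ext_iff] at this
      exact (eq_of_heq this.2).symm
  rw [key, key, ← Finset.mul_prod_erase _ _ (Finset.mem_univ m.1),
    ← Finset.mul_prod_erase (a := m.1) _ _ (Finset.mem_univ m.1)]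
  have h1 : ∑ a : A m.1 with ∀ n ∈ m :: l, n.1 = m.1 → n = ⟨m.1, a⟩, β m.1 a = β m.1 m.2 := by
    rw [Finset.sum_eq_single_of_mem m.2]
    · simp only [Finset.mem_filter, Finset.mem_univ, true_and, List.mem_cons]
      rintro n (rfl | hn) h
      · rfl
      · exact absurd h (hm n hn)
    · intro a ha hne
      have := (Finset.mem_filter.1 ha).2 m List.mem_cons_self rfl
      rw [Sigma.ext_iff] at this
      exact absurd (eq_of_heq this.2).symm hne
  have h2 : ∑ a : A m.1 with ∀ n ∈ l, n.1 = m.1 → n = ⟨m.1, a⟩, β m.1 a = 1 := by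
    rw [← hβ m.1, Finset.filter_true_of_mem fun a _ n hn h => absurd h (hm n hn)]
  rw [h1, h2, one_mul]
  congr 1
  refine Finset.prod_congr rfl fun k hk => Finset.sum_congr ?_ fun _ _ => rfl
  ext a
  simp [(Finset.ne_of_mem_erase hk).symm]

/-- Every realization plan is induced by a mixed strategy. -/
theorem IsRealizationPlan.exists_mixed {i : Player} {x : G.Seq i → ℝ}
    (hx : G.IsRealizationPlan x) :
    ∃ w ∈ stdSimplex ℝ (G.Plan i), ∀ σ, ∑ π, w π * G.planIndicator π σ = x σ := by
  classical
  have : Fintype (G.Infoset i) := Fintype.ofFinite _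
  obtain ⟨β, h1, h2, h3⟩ := IsRealizationPlan.exists_behavior G hx
  -- Independent choices at all information sets, drawn from `β`, follow `σ` with probability `x σ`.
  have hsum : ∀ σ : G.Seq i,
      ∑ s : ∀ I : G.Infoset i, {a : G.Action // a ∈ G.actions I} with
        ∀ m ∈ G.seqHist σ, s m.1 = m.2, ∏ I, β I (s I) = x σ := by
    intro σ
    induction σ using G.seq_induction with
    | h0 =>
      have := (Finset.prod_univ_sum (fun _ => Finset.univ) β).symm
      simp only [h2, Finset.prod_const_one, Fintype.piFinset_univ] at this
      simpa [seqHist, hx.2.1] using this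
    | hs I a ih =>
      rw [seqHist_parentSeq] at ih
      rw [h3, ← ih]
      exact sum_prod_cons_filter β h2 ⟨I, a⟩ _ fun n hn => G.ne_of_mem_infosetHist hn
  -- Pushing this product distribution forward along `reducePlan` gives the mixed strategy.
  have hpush : ∀ σ : G.Seq i,
      ∑ π, (∑ s with G.reducePlan s = π, ∏ I, β I (s I)) * G.planIndicator π σ = x σ := by
    intro σ
    rw [← hsum σ, Finset.sum_filter]
    simp only [← reducePlan_mem_plansOf]
    rw [← Finset.sum_fiberwise (s := Finset.univ) (g := G.reducePlan)]
    refine Finset.sum_congr rfl fun π _ => ?_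
    rw [Finset.sum_mul]
    refine Finset.sum_congr rfl fun s hs => ?_
    rw [(Finset.mem_filter.1 hs).2]
    simp [planIndicator]
  refine ⟨fun π => ∑ s with G.reducePlan s = π, ∏ I, β I (s I), ⟨fun π => ?_, ?_⟩, hpush⟩
  · exact Finset.sum_nonneg fun s _ => Finset.prod_nonneg fun I _ => h1 I _
  -- Every plan contains the empty sequence, so the identity at `none` computes the total mass.
  · have := hpush none
    rw [hx.2.1] at this
    simpa [planIndicator, plansOf] using this

/-! ### Correlation plans -/

theorem correlationPlan_apply (i j : Player) (μ : G.Plan i × G.Plan j → ℝ) (p : G.RelPair i j) :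
    G.correlationPlan i j μ p =
      ∑ π, μ π * (G.planIndicator π.1 p.1.1 * G.planIndicator π.2 p.1.2) := by
  classical
  rw [correlationPlan, Finset.sum_filter]
  refine Finset.sum_congr rfl fun π _ => ?_
  by_cases h1 : π.1 ∈ G.plansOf p.1.1 <;> by_cases h2 : π.2 ∈ G.plansOf p.1.2 <;>
    simp [planIndicator, h1, h2]

theorem convex_correlationPlans (i j : Player) : Convex ℝ (G.correlationPlans i j) := by
  refine (convex_stdSimplex ℝ _).is_linear_image ⟨fun μ ν => ?_, fun c μ => ?_⟩
  · ext p
    simp [correlationPlan_apply, add_mul, Finset.sum_add_distrib]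
  · ext p
    simp [correlationPlan_apply, mul_assoc, Finset.mul_sum]

theorem mul_mem_correlationPlans {i j : Player} {x : G.Seq i → ℝ} {y : G.Seq j → ℝ}
    (hx : G.IsRealizationPlan x) (hy : G.IsRealizationPlan y) :
    (fun p : G.RelPair i j => x p.1.1 * y p.1.2) ∈ G.correlationPlans i j := by
  obtain ⟨w, hw, hwx⟩ := IsRealizationPlan.exists_mixed G hx
  obtain ⟨w', hw', hwy⟩ := IsRealizationPlan.exists_mixed G hy
  refine ⟨fun π => w π.1 * w' π.2, ⟨fun π => mul_nonneg (hw.1 _) (hw'.1 _), ?_⟩, ?_⟩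
  · rw [Fintype.sum_prod_type, ← Fintype.sum_mul_sum, hw.2, hw'.2, mul_one]
  · ext p
    rw [correlationPlan_apply, ← hwx, ← hwy, Fintype.sum_mul_sum, Fintype.sum_prod_type]
    exact Finset.sum_congr rfl fun _ _ => Finset.sum_congr rfl fun _ _ => by ring

theorem mul_mem_vonStengelForges {i j : Player} {x : G.Seq i → ℝ} {y : G.Seq j → ℝ}
    (hx : G.IsRealizationPlan x) (hy : G.IsRealizationPlan y) :
    (fun p : G.RelPair i j => x p.1.1 * y p.1.2) ∈ G.vonStengelForges i j := by
  refine ⟨fun p => mul_nonneg (hx.1 _) (hy.1 _), by simp [hx.2.1, hy.2.1], fun I τ h => ?_,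
    fun J σ h => ?_⟩
  · simp only [← hx.2.2 I, Finset.sum_mul]
  · simp only [← hy.2.2 J, Finset.mul_sum]

/-- Correlation plans are mixtures of products of reduced-normal-form plans. -/
theorem correlationPlans_subset {i j : Player} {S : Set (G.RelPair i j → ℝ)} (hS : Convex ℝ S)
    (h : ∀ (π : G.Plan i) (ρ : G.Plan j),
      (fun p : G.RelPair i j => G.planIndicator π p.1.1 * G.planIndicator ρ p.1.2) ∈ S) :
    G.correlationPlans i j ⊆ S := by
  rintro _ ⟨μ, hμ, rfl⟩
  have := hS.sum_mem (t := Finset.univ) (w := μ)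
    (z := fun π p => G.planIndicator π.1 p.1.1 * G.planIndicator π.2 p.1.2)
    (fun π _ => hμ.1 π) hμ.2 fun π _ => h π.1 π.2
  convert this using 1
  ext p
  simp [correlationPlan_apply]

theorem planIndicator_mul_mem_semiRandomizedFst {i j : Player} (π : G.Plan i) (ρ : G.Plan j) :
    (fun p : G.RelPair i j => G.planIndicator π p.1.1 * G.planIndicator ρ p.1.2) ∈
      G.semiRandomizedFst i j := by
  have hπ := G.isRealizationPlan_planIndicator π
  refine ⟨G.mul_mem_vonStengelForges hπ (G.isRealizationPlan_planIndicator ρ), fun τ => ?_⟩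
  simpa only [hπ.2.1, one_mul] using G.planIndicator_mem ρ τ

theorem planIndicator_mul_mem_semiRandomizedSnd {i j : Player} (π : G.Plan i) (ρ : G.Plan j) :
    (fun p : G.RelPair i j => G.planIndicator π p.1.1 * G.planIndicator ρ p.1.2) ∈
      G.semiRandomizedSnd i j := by
  have hρ := G.isRealizationPlan_planIndicator ρ
  refine ⟨G.mul_mem_vonStengelForges (G.isRealizationPlan_planIndicator π) hρ, fun σ => ?_⟩
  simpa only [hρ.2.1, mul_one] using G.planIndicator_mem π σ

/-! ### Semi-randomized correlation plans are products -/

theorem Relevant.relevantInfo {i j : Player} {σ : G.Seq i} {n : G.Move j}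
    (h : G.Relevant σ (some n)) : G.RelevantInfo σ n.1 := by
  rintro m rfl
  rcases h with h | h | ⟨m', n', h1, h2, h⟩
  · cases h
  · cases h
  · cases h1
    cases h2
    exact h

theorem relevantInfo_none {i j : Player} (J : G.Infoset j) :
    G.RelevantInfo (none : G.Seq i) J := fun _ h => by cases h

/-- The vector with the roles of the two players exchanged. -/
def swapPlan {i j : Player} (ξ : G.RelPair i j → ℝ) : G.RelPair j i → ℝ :=
  fun p => ξ ⟨(p.1.2, p.1.1), Relevant.symm G p.2⟩

theorem swapPlan_mem_vonStengelForges {i j : Player} {ξ : G.RelPair i j → ℝ}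
    (hξ : ξ ∈ G.vonStengelForges i j) : G.swapPlan ξ ∈ G.vonStengelForges j i :=
  ⟨fun _ => hξ.1 _, hξ.2.1, fun I τ h => hξ.2.2.2 I τ h, fun J σ h => hξ.2.2.1 J σ h⟩

theorem isRealizationPlan_snd {i j : Player} {ξ : G.RelPair i j → ℝ}
    (hξ : ξ ∈ G.vonStengelForges i j) :
    G.IsRealizationPlan fun τ : G.Seq j => ξ ⟨(none, τ), Or.inl rfl⟩ :=
  ⟨fun _ => hξ.1 _, hξ.2.1, fun J => hξ.2.2.2 J none (G.relevantInfo_none J)⟩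

theorem isRealizationPlan_fst {i j : Player} {ξ : G.RelPair i j → ℝ}
    (hξ : ξ ∈ G.vonStengelForges i j) :
    G.IsRealizationPlan fun σ : G.Seq i => ξ ⟨(σ, none), Or.inr (Or.inl rfl)⟩ :=
  G.isRealizationPlan_snd (G.swapPlan_mem_vonStengelForges hξ)

/-- Passing from a sequence to its parent keeps the pair relevant and does not decrease `ξ`, since
the parent's value is a sum of nonnegative terms including the given one. -/
theorem le_none_of_mem_vonStengelForges {i j : Player} {ξ : G.RelPair i j → ℝ}
    (hξ : ξ ∈ G.vonStengelForges i j) (τ : G.Seq j) (σ : G.Seq i) :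
    ∀ h : G.Relevant σ τ, ξ ⟨(σ, τ), h⟩ ≤ ξ ⟨(none, τ), Or.inl rfl⟩ := by
  induction σ using G.seq_induction with
  | h0 => exact fun _ => le_rfl
  | hs I a ih =>
    intro h
    have hI : G.RelevantInfo τ I := Relevant.relevantInfo G (n := ⟨I, a⟩) (Relevant.symm G h)
    refine le_trans ?_ (ih (Relevant.symm G (G.relevant_parentSeq hI)))
    rw [← hξ.2.2.1 I τ hI]
    exact Finset.single_le_sum
      (f := fun a => ξ ⟨(some ⟨I, a⟩, τ), Relevant.symm G (G.relevant_move hI a)⟩)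
      (fun _ _ => hξ.1 _) (Finset.mem_univ a)

/-- Induction on `τ = (J, b)`. If `ξ[∅, τ] = 0`, domination by the marginal makes both sides vanish.
If it is 1, the parent of `τ` also has marginal 1 and the other actions at `J` have marginal 0; by
domination the constraint at `J` collapses to `ξ[σ, τ] = ξ[σ, σ(J)]`. -/
theorem eq_mul_of_mem_semiRandomizedFst {i j : Player} {ξ : G.RelPair i j → ℝ}
    (hξ : ξ ∈ G.semiRandomizedFst i j) (σ : G.Seq i) (τ : G.Seq j) :
    ∀ h : G.Relevant σ τ, ξ ⟨(σ, τ), h⟩ =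
      ξ ⟨(σ, none), Or.inr (Or.inl rfl)⟩ * ξ ⟨(none, τ), Or.inl rfl⟩ := by
  classical
  obtain ⟨hV, h01⟩ := hξ
  induction τ using G.seq_induction with
  | h0 => exact fun _ => by rw [hV.2.1, mul_one]
  | hs J b ih =>
    intro h
    rcases h01 (some ⟨J, b⟩) with h0 | h1
    · have := G.le_none_of_mem_vonStengelForges hV _ σ h
      rw [h0] at this ⊢
      rw [mul_zero]
      exact le_antisymm this (hV.1 _)
    · have hJ : G.RelevantInfo σ J := Relevant.relevantInfo G (n := ⟨J, b⟩) h
      have hsum := hV.2.2.2 J none (G.relevantInfo_none J)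
      rw [Set.mem_singleton_iff] at h1
      rw [← Finset.add_sum_erase _ _ (Finset.mem_univ b), h1] at hsum
      have hnn : 0 ≤ ∑ c ∈ Finset.univ.erase b,
          ξ ⟨(none, some (⟨J, c⟩ : G.Move j)), Or.inl rfl⟩ :=
        Finset.sum_nonneg fun _ _ => hV.1 _
      -- The parent's marginal is at least that of `b`, which is 1, so it cannot be 0.
      have hp : ξ ⟨(none, G.parentSeq J), Or.inl rfl⟩ = 1 := by
        rcases h01 (G.parentSeq J) with hp | hp
        · rw [hp] at hsum; linarith
        · exact hp
      have hz : ∑ c ∈ Finset.univ.erase b,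
          ξ ⟨(none, some (⟨J, c⟩ : G.Move j)), Or.inl rfl⟩ = 0 := by
        rw [hp] at hsum; linarith
      rw [Finset.sum_eq_zero_iff_of_nonneg fun _ _ => hV.1 _] at hz
      have hsingle := hV.2.2.2 J σ hJ
      rw [Finset.sum_eq_single b, ih (G.relevant_parentSeq hJ), hp] at hsingle
      · rw [h1]
        exact hsingle
      · intro c _ hc
        refine le_antisymm ?_ (hV.1 _)
        rw [← hz c (Finset.mem_erase.2 ⟨hc, Finset.mem_univ c⟩)]
        exact G.le_none_of_mem_vonStengelForges hV _ σ _
      · exact fun hb => absurd (Finset.mem_univ b) hb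

theorem semiRandomizedFst_subset (i j : Player) :
    G.semiRandomizedFst i j ⊆ G.correlationPlans i j := by
  intro ξ hξ
  convert G.mul_mem_correlationPlans (G.isRealizationPlan_fst hξ.1)
    (G.isRealizationPlan_snd hξ.1) using 1
  ext p
  exact G.eq_mul_of_mem_semiRandomizedFst hξ _ _ p.2

theorem semiRandomizedSnd_subset (i j : Player) :
    G.semiRandomizedSnd i j ⊆ G.correlationPlans i j := by
  intro ξ hξ
  convert G.mul_mem_correlationPlans (G.isRealizationPlan_fst hξ.1)
    (G.isRealizationPlan_snd hξ.1) using 1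
  ext p
  rw [mul_comm]
  exact G.eq_mul_of_mem_semiRandomizedFst (ξ := G.swapPlan ξ)
    ⟨G.swapPlan_mem_vonStengelForges hξ.1, hξ.2⟩ _ _ (Relevant.symm G p.2)

end Game

theorem mainTheorem2 (G : Game.{u, v}) :
    G.correlationPlans .T1 .T2 = convexHull ℝ (G.semiRandomizedFst .T1 .T2) ∧
    G.correlationPlans .T1 .T2 = convexHull ℝ (G.semiRandomizedSnd .T1 .T2) ∧
    G.correlationPlans .T1 .T2 =
      convexHull ℝ (G.semiRandomizedFst .T1 .T2 ∪ G.semiRandomizedSnd .T1 .T2) := by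
  have hF := G.semiRandomizedFst_subset .T1 .T2
  have hS := G.semiRandomizedSnd_subset .T1 .T2
  have hC := G.convex_correlationPlans .T1 .T2
  refine ⟨Set.Subset.antisymm ?_ (convexHull_min hF hC),
    Set.Subset.antisymm ?_ (convexHull_min hS hC),
    Set.Subset.antisymm ?_ (convexHull_min (Set.union_subset hF hS) hC)⟩ <;>
    refine G.correlationPlans_subset (convex_convexHull ℝ _) fun π ρ => subset_convexHull ℝ _ ?_
  · exact G.planIndicator_mul_mem_semiRandomizedFst π ρ
  · exact G.planIndicator_mul_mem_semiRandomizedSnd π ρ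
  · exact Or.inl (G.planIndicator_mul_mem_semiRandomizedFst π ρ)
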